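/- Let $(v_n)_{n\ge 1}$ be any strictly increasing sequence of real numbers (for instance $v_n=n$). There exist, on some probability space, a random variable $\Pi$ with values in $\{1,2,\dots\}$ (almost surely) and a sequence $(X_j)_{j\ge 1}$ of real random variables such that: (a) $P(\Pi=k)=\frac{1}{k(k+1)}$ for every $k\ge 1$ and, conditionally on $\Pi=k$, the variables $X_1,X_2,\dots$ are i.i.d. with the purely atomic law on $\{v_n:n\ge k^2\}$ whose distribution function $F_k$ satisfies $F_k(x)=0$ for $x<v_{k^2}$ and $F_k(x)=1-\frac1n$ for $v_n\le x<v_{n+1}$, $n\ge k^2$; (b) $(X_j)$ is strictly stationary, and moreover exchangeable (its law is invariant under finite permutations of the indices); (c) $(X_j)$ admits a continuous phantom distribution function: writing $M_n=\max_{1\le j\le n}X_j$, there is a continuous distribution function $G$ on $\mathbb R$ such that $P(M_n\le u_n)-G(u_n)^n\to 0$ as $n\to\infty$ for every sequence $(u_n)$ of real numbers; (d) $(X_j)$ has extremal index $0$: writing $F(x)=P(X_1\le x)$, for every $\tau\in(0,\infty)$ there is a real sequence $(u_n)$ with $n(1-F(u_n))\to\tau$, and for every such sequence $P(M_n\le u_n)\to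 1$; (e) $(X_j)$ is not ergodic: the left shift on $\mathbb R^{\mathbb N}$ is not ergodic with respect to the law of $(X_j)$. In particular, there exists a non-ergodic stationary sequence which admits a continuous phantom distribution function and has extremal index $0$. -/

import Mathlib

open MeasureTheory ProbabilityTheory Filter Topology

noncomputable section

/- Sequences are indexed from `0`: the variable `X j` plays the role of `X_{j+1}`, so that
`X 0, …, X (n - 1)` are the first `n` variables. -/

/-- The partial maximum of the first `n` variables (a genuine maximum for `n ≥ 1`). -/
def partialMax {Ω : Type*} (X : ℕ → Ω → ℝ) (n : ℕ) (ω : Ω) : ℝ :=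
  ⨆ j : Fin n, X j ω

/-- The distribution function of the partial maximum, `u ↦ P(M_n ≤ u)`. -/
def maxDF {Ω : Type*} [MeasurableSpace Ω] (P : Measure Ω) (X : ℕ → Ω → ℝ) (n : ℕ) (u : ℝ) : ℝ :=
  P.real {ω | partialMax X n ω ≤ u}

/-- The marginal distribution function, that of the first variable. -/
def marginalDF {Ω : Type*} [MeasurableSpace Ω] (P : Measure Ω) (X : ℕ → Ω → ℝ) (u : ℝ) : ℝ :=
  P.real {ω | X 0 ω ≤ u}

/-- The sample path of a sequence of random variables. -/
def samplePath {Ω : Type*} (X : ℕ → Ω → ℝ) (ω : Ω) : ℕ → ℝ := fun j => X j ω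

/-- The left shift on real sequences. -/
def seqShift (x : ℕ → ℝ) : ℕ → ℝ := fun j => x (j + 1)

/-- Strict stationarity: the shifted sequence has the same law. -/
def IsStationarySeq {Ω : Type*} [MeasurableSpace Ω] (P : Measure Ω) (X : ℕ → Ω → ℝ) : Prop :=
  (∀ j, Measurable (X j)) ∧
    P.map (samplePath fun j => X (j + 1)) = P.map (samplePath X)

/-- Exchangeability: the law is invariant under finite permutations of the indices. -/
def IsExchangeableSeq {Ω : Type*} [MeasurableSpace Ω] (P : Measure Ω) (X : ℕ → Ω → ℝ) : Prop :=
  (∀ j, Measurable (X j)) ∧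
    ∀ σ : Equiv.Perm ℕ, {j | σ j ≠ j}.Finite →
      P.map (samplePath fun j => X (σ j)) = P.map (samplePath X)

/-- A sequence is ergodic if the shift is ergodic for its law on the space of sequences. -/
def IsErgodicSeq {Ω : Type*} [MeasurableSpace Ω] (P : Measure Ω) (X : ℕ → Ω → ℝ) : Prop :=
  Ergodic seqShift (P.map (samplePath X))

/-- Distribution functions of probability measures on the line. -/
structure IsDistributionFunction (G : ℝ → ℝ) : Prop where
  mono : Monotone G
  right_cont : ∀ x, ContinuousWithinAt G (Set.Ici x) x
  lim_bot : Tendsto G atBot (𝓝 0)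
  lim_top : Tendsto G atTop (𝓝 1)

/-- `G` is a phantom distribution function for `X`: `P(M_n ≤ u_n) - G(u_n)^n → 0` for every
real sequence `u`. -/
def IsPhantomDF {Ω : Type*} [MeasurableSpace Ω] (P : Measure Ω) (X : ℕ → Ω → ℝ)
    (G : ℝ → ℝ) : Prop :=
  IsDistributionFunction G ∧
    ∀ u : ℕ → ℝ, Tendsto (fun n : ℕ => maxDF P X n (u n) - G (u n) ^ n) atTop (𝓝 0)

/-- Extremal index zero: for every `τ ∈ (0, ∞)` there are levels with `n (1 - F(u_n)) → τ`, and
`P(M_n ≤ u_n) → 1` for all such levels. -/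
def HasExtremalIndexZero {Ω : Type*} [MeasurableSpace Ω] (P : Measure Ω)
    (X : ℕ → Ω → ℝ) : Prop :=
  ∀ τ : ℝ, 0 < τ →
    (∃ u : ℕ → ℝ, Tendsto (fun n : ℕ => (n : ℝ) * (1 - marginalDF P X (u n))) atTop (𝓝 τ)) ∧
    ∀ u : ℕ → ℝ, Tendsto (fun n : ℕ => (n : ℝ) * (1 - marginalDF P X (u n))) atTop (𝓝 τ) →
      Tendsto (fun n : ℕ => maxDF P X n (u n)) atTop (𝓝 1)

/-- `μ` is the purely atomic law on `{v_n : n ≥ k²}` whose distribution function `F_k` vanishes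
below `v_{k²}` and equals `1 - 1/n` on `[v_n, v_{n+1})` for `n ≥ k²`. -/
def IsJumpLaw (v : ℕ → ℝ) (k : ℕ) (μ : Measure ℝ) : Prop :=
  μ (v '' Set.Ici (k ^ 2)) = 1 ∧
  (∀ x, x < v (k ^ 2) → cdf μ x = 0) ∧
  ∀ n, k ^ 2 ≤ n → ∀ x, v n ≤ x → x < v (n + 1) → cdf μ x = 1 - 1 / (n : ℝ)

/-- `X` is the mixture of i.i.d. sequences directed by `K`: `P(K = k) = 1 / (k (k + 1))` for
`k ≥ 1` and, given `K = k`, the variables are i.i.d. with the jump law number `k`. -/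
def IsJumpMixture {Ω : Type*} [MeasurableSpace Ω] (P : Measure Ω) (v : ℕ → ℝ)
    (K : Ω → ℕ) (X : ℕ → Ω → ℝ) : Prop :=
  Measurable K ∧ (∀ j, Measurable (X j)) ∧
  ∃ μ : ℕ → ProbabilityMeasure ℝ, ∀ k, 1 ≤ k →
    IsJumpLaw v k (μ k : Measure ℝ) ∧
    P.real (K ⁻¹' {k}) = 1 / ((k : ℝ) * ((k : ℝ) + 1)) ∧
    (ProbabilityTheory.cond P (K ⁻¹' {k})).map (samplePath X)
      = Measure.infinitePi fun _ : ℕ => (μ k : Measure ℝ)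

end

/-! Realize the mixture explicitly: with `K` and the `ξ_j` independent, `ξ_j` having mass
`1/((i+1)(i+2))` at `i` and `K - 1` the same law, put `X_j = v (max (ξ_j + 2) (K²))`. For `u` in `[v
m, v (m+1))` and `n ≥ 1`, `P(M_n ≤ u) = (1 - 1/(√m + 1)) (1 - 1/m)^n`, with `√m` the integer square
root (`maxDF_jumpSeq_of_mem_Ico`); the rest is read off this formula.

The factor due to `K` is far from 1 only for bounded `m`, where `(1 - 1/m)^n → 0` anyway. So any
continuous interpolation of `v m ↦ 1 - 1/m` is a phantom distribution function
(`abs_maxDF_jumpSeq_sub_interpDF_pow_le`). The marginal tail is instead of order `1/√m`, dominated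
by `K`: if `n (1 - F(u_n)) → τ` then `m` is of order `n²`, so `n/m → 0` and `P(M_n ≤ u_n) → 1`
(`one_sub_maxDF_jumpSeq_le`). Ergodicity fails because the path reveals information about `K`. -/

noncomputable section

/-! ### The telescoping law and the explicit model -/

/-- The weight of the atom `i` of the law on `ℕ` with distribution function `1 - 1 / (i + 2)`. -/
def telescopingWeight (i : ℕ) : ℝ := 1 / (((i : ℝ) + 1) * ((i : ℝ) + 2))

lemma telescopingWeight_pos (i : ℕ) : 0 < telescopingWeight i := by
  unfold telescopingWeight; positivity

lemma sum_range_telescopingWeight (n : ℕ) :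
    ∑ i ∈ Finset.range n, telescopingWeight i = 1 - 1 / ((n : ℝ) + 1) := by
  induction n with
  | zero => simp
  | succ n ih =>
    rw [Finset.sum_range_succ, ih, telescopingWeight]
    push_cast
    field_simp
    ring

lemma hasSum_telescopingWeight : HasSum telescopingWeight 1 := by
  rw [hasSum_iff_tendsto_nat_of_nonneg fun i => (telescopingWeight_pos i).le]
  simp_rw [sum_range_telescopingWeight]
  simpa using tendsto_one_div_add_atTop_nhds_zero_nat (𝕜 := ℝ) |>.const_sub 1

/-- The probability mass function with weights `1 / ((i + 1) (i + 2))`. -/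
def telescopingPMF : PMF ℕ :=
  ⟨fun i => ENNReal.ofReal (telescopingWeight i), by
    have h := ENNReal.ofReal_tsum_of_nonneg (fun i => (telescopingWeight_pos i).le)
      hasSum_telescopingWeight.summable
    rw [hasSum_telescopingWeight.tsum_eq, ENNReal.ofReal_one] at h
    exact h ▸ ENNReal.summable.hasSum⟩

/-- The law on `ℕ` with weights `1 / ((i + 1) (i + 2))`. -/
def telescopingLaw : Measure ℕ := telescopingPMF.toMeasure

instance : IsProbabilityMeasure telescopingLaw :=
  inferInstanceAs (IsProbabilityMeasure telescopingPMF.toMeasure)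

lemma telescopingLaw_real_singleton (i : ℕ) :
    telescopingLaw.real {i} = telescopingWeight i := by
  rw [measureReal_def, telescopingLaw, PMF.toMeasure_apply_singleton _ _ (measurableSet_singleton i)]
  exact ENNReal.toReal_ofReal (telescopingWeight_pos i).le

lemma telescopingLaw_real_Iio (n : ℕ) :
    telescopingLaw.real (Set.Iio n) = 1 - 1 / ((n : ℝ) + 1) := by
  rw [← sum_range_telescopingWeight, ← Finset.coe_range, ← sum_measureReal_singleton]
  exact Finset.sum_congr rfl fun i _ => telescopingLaw_real_singleton i

/-- The product law of the directing variable and of the innovations. -/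
def jumpMeasure : Measure (ℕ × (ℕ → ℕ)) :=
  telescopingLaw.prod (Measure.infinitePi fun _ : ℕ => telescopingLaw)

instance : IsProbabilityMeasure jumpMeasure :=
  inferInstanceAs (IsProbabilityMeasure (telescopingLaw.prod _))

/-- The directing variable. -/
def jumpIndex (ω : ℕ × (ℕ → ℕ)) : ℕ := ω.1 + 1

/-- The mixture of i.i.d. sequences driven by `jumpIndex`. -/
def jumpSeq (v : ℕ → ℝ) (j : ℕ) (ω : ℕ × (ℕ → ℕ)) : ℝ :=
  v (max (ω.2 j + 2) (jumpIndex ω ^ 2))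

lemma measurable_jumpIndex : Measurable jumpIndex :=
  measurable_fst.add_const 1

lemma measurable_jumpSeq (v : ℕ → ℝ) (j : ℕ) : Measurable (jumpSeq v j) :=
  (measurable_from_top (f := v)).comp
    ((((measurable_pi_apply j).comp measurable_snd).add_const 2).max
      (measurable_jumpIndex.pow_const 2))

lemma measurable_samplePath {Ω : Type*} [MeasurableSpace Ω] {X : ℕ → Ω → ℝ}
    (hX : ∀ j, Measurable (X j)) : Measurable (samplePath X) :=
  measurable_pi_lambda _ hX

/-! ### Conditional laws given the directing variable -/

/-- The jump law number `k`, as the law of an explicit function of a telescoping variable. -/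
def jumpLaw (v : ℕ → ℝ) (k : ℕ) : Measure ℝ :=
  telescopingLaw.map fun i => v (max (i + 2) (k ^ 2))

instance (v : ℕ → ℝ) (k : ℕ) : IsProbabilityMeasure (jumpLaw v k) :=
  Measure.isProbabilityMeasure_map measurable_from_top.aemeasurable

lemma jumpLaw_isJumpLaw {v : ℕ → ℝ} (hv : StrictMono v) {k : ℕ} (hk : 1 ≤ k) :
    IsJumpLaw v k (jumpLaw v k) := by
  refine ⟨?_, fun x hx => ?_, fun n hn x hx hx' => ?_⟩
  · rw [jumpLaw, Measure.map_apply measurable_from_top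
      ((Set.to_countable _).image v).measurableSet]
    convert measure_univ (μ := telescopingLaw)
    ext i
    simp only [Set.mem_preimage, Set.mem_univ, iff_true]
    exact ⟨_, Set.mem_Ici.2 (le_max_right _ _), rfl⟩
  · rw [cdf_eq_real, jumpLaw, map_measureReal_apply measurable_from_top measurableSet_Iic]
    have : (fun i => v (max (i + 2) (k ^ 2))) ⁻¹' Set.Iic x = ∅ :=
      Set.eq_empty_of_forall_notMem fun i (hi : v _ ≤ x) =>
        absurd (hx.trans_le (hv.monotone (le_max_right _ _))) hi.not_gt
    rw [this, measureReal_empty]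
  · rw [cdf_eq_real, jumpLaw, map_measureReal_apply measurable_from_top measurableSet_Iic]
    have hn1 : 1 ≤ n := (Nat.one_le_pow _ _ hk).trans hn
    -- Since `k² ≤ n`, only `i + 2 ≤ n` matters; `1 ≤ n` keeps the truncated `n - 1` harmless in the
    -- cast below.
    have : (fun i => v (max (i + 2) (k ^ 2))) ⁻¹' Set.Iic x = Set.Iio (n - 1) := by
      ext i
      simp only [Set.mem_preimage, Set.mem_Iic, Set.mem_Iio]
      constructor
      · intro h
        have := hv.lt_iff_lt.1 (h.trans_lt hx')
        have := (le_max_left (i + 2) (k ^ 2)).trans_lt this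
        omega
      · intro h
        exact (hv.monotone (max_le (by omega) hn)).trans hx
    rw [this, telescopingLaw_real_Iio, Nat.cast_sub hn1]
    simp

lemma jumpMeasure_real_prod (A : Set ℕ) (B : Set (ℕ → ℕ)) :
    jumpMeasure.real (A ×ˢ B) =
      telescopingLaw.real A * (Measure.infinitePi fun _ : ℕ => telescopingLaw).real B :=
  measureReal_prod_prod A B

lemma jumpMeasure_isJumpMixture {v : ℕ → ℝ} (hv : StrictMono v) :
    IsJumpMixture jumpMeasure v jumpIndex (jumpSeq v) := by
  refine ⟨measurable_jumpIndex, measurable_jumpSeq v, fun k => ⟨jumpLaw v k, inferInstance⟩,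
    fun k hk => ⟨jumpLaw_isJumpLaw hv hk, ?_, ?_⟩⟩ <;>
  obtain ⟨i, rfl⟩ : ∃ i, k = i + 1 := ⟨k - 1, by omega⟩
  all_goals
    have hK : jumpIndex ⁻¹' {i + 1} = ({i} : Set ℕ) ×ˢ (Set.univ : Set (ℕ → ℕ)) := by
      ext ω; simp [jumpIndex]
  · rw [hK, jumpMeasure_real_prod, telescopingLaw_real_singleton, telescopingWeight,
      probReal_univ, mul_one]
    push_cast
    ring
  · have hmap : Measure.infinitePi (fun _ : ℕ => jumpLaw v (i + 1)) =
        (Measure.infinitePi fun _ : ℕ => telescopingLaw).map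
          fun x j => v (max (x j + 2) ((i + 1) ^ 2)) :=
      (Measure.infinitePi_map_pi (fun _ : ℕ => telescopingLaw)
        (f := fun _ n => v (max (n + 2) ((i + 1) ^ 2))) fun _ => measurable_from_top).symm
    change _ = Measure.infinitePi (fun _ : ℕ => jumpLaw v (i + 1))
    rw [hmap]
    have hm : Measurable fun (x : ℕ → ℕ) j => v (max (x j + 2) ((i + 1) ^ 2)) :=
      measurable_pi_lambda _ fun j =>
        (measurable_from_top (f := fun n => v (max (n + 2) ((i + 1) ^ 2)))).comp
          (measurable_pi_apply j)
    ext A hA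
    rw [Measure.map_apply (measurable_samplePath (measurable_jumpSeq v)) hA,
      Measure.map_apply hm hA, cond_apply (measurable_jumpIndex (measurableSet_singleton _)), hK]
    have : ({i} : Set ℕ) ×ˢ (Set.univ : Set (ℕ → ℕ)) ∩ samplePath (jumpSeq v) ⁻¹' A =
        ({i} : Set ℕ) ×ˢ ((fun (x : ℕ → ℕ) j => v (max (x j + 2) ((i + 1) ^ 2))) ⁻¹' A) := by
      ext ⟨a, x⟩
      simp only [Set.mem_inter_iff, Set.mem_prod, Set.mem_singleton_iff, Set.mem_univ, and_true,
        Set.mem_preimage]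
      refine and_congr_right ?_
      rintro rfl
      rfl
    rw [this, jumpMeasure, Measure.prod_prod, Measure.prod_prod, measure_univ, mul_one, ← mul_assoc,
      ENNReal.inv_mul_cancel, one_mul]
    · intro h
      have := telescopingLaw_real_singleton i
      rw [measureReal_def, h] at this
      exact (telescopingWeight_pos i).ne this
    · exact measure_ne_top _ _

/-! ### Stationarity, exchangeability, non-ergodicity -/

/-- Reindexing acts on the i.i.d. innovations only, leaving the directing variable fixed.
Injectivity suffices, which covers both the shift and permutations. -/
lemma map_samplePath_jumpSeq_comp (v : ℕ → ℝ) {f : ℕ → ℕ} (hf : f.Injective) :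
    jumpMeasure.map (samplePath fun j => jumpSeq v (f j)) =
      jumpMeasure.map (samplePath (jumpSeq v)) := by
  have hinj : (Measure.infinitePi fun _ : ℕ => telescopingLaw).map (fun x j => x (f j)) =
      Measure.infinitePi fun _ : ℕ => telescopingLaw :=
    Measure.map_infinitePi_infinitePi_of_inj hf
  have hm : Measurable fun (x : ℕ → ℕ) j => x (f j) :=
    measurable_pi_lambda _ fun j => measurable_pi_apply _
  have hprod : jumpMeasure.map (Prod.map id fun (x : ℕ → ℕ) j => x (f j)) = jumpMeasure := by
    rw [jumpMeasure, ← Measure.map_prod_map _ _ measurable_id hm, hinj, Measure.map_id]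
  conv_rhs => rw [← hprod]
  rw [Measure.map_map (measurable_samplePath (measurable_jumpSeq v)) (measurable_id.prodMap hm)]
  rfl

lemma jumpSeq_isStationarySeq (v : ℕ → ℝ) : IsStationarySeq jumpMeasure (jumpSeq v) :=
  ⟨measurable_jumpSeq v, map_samplePath_jumpSeq_comp v (add_left_injective 1)⟩

lemma jumpSeq_isExchangeableSeq (v : ℕ → ℝ) : IsExchangeableSeq jumpMeasure (jumpSeq v) :=
  ⟨measurable_jumpSeq v, fun σ _ => map_samplePath_jumpSeq_comp v σ.injective⟩

lemma jumpSeq_not_isErgodicSeq {v : ℕ → ℝ} (hv : StrictMono v) :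
    ¬ IsErgodicSeq jumpMeasure (jumpSeq v) := by
  intro h
  have hmeas := measurable_samplePath (measurable_jumpSeq v)
  -- `K = 2` forces every coordinate up to at least `v 4`, while `K = 1` with first innovation 0
  -- gives `X 0 = v 2`. Both events have positive mass, and `B` is contained in its preimage under
  -- the shift.
  let B : Set (ℕ → ℝ) := {x | ∀ j, v 4 ≤ x j}
  have hB : MeasurableSet B := by
    have : B = ⋂ j, {x | v 4 ≤ x j} := by ext; simp [B]
    rw [this]
    exact MeasurableSet.iInter fun j => measurableSet_le measurable_const (measurable_pi_apply j)
  have : IsProbabilityMeasure (jumpMeasure.map (samplePath (jumpSeq v))) :=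
    Measure.isProbabilityMeasure_map hmeas.aemeasurable
  have pos : ∀ i, 0 < telescopingLaw {i} := fun i => by
    have := telescopingLaw_real_singleton i ▸ telescopingWeight_pos i
    exact (ENNReal.toReal_pos_iff.1 this).1
  rcases h.ae_empty_or_univ_of_ae_le_preimage hB.nullMeasurableSet
    (LE.le.eventuallyLE fun x (hx : ∀ j, v 4 ≤ x j) j => hx (j + 1)) with h0 | h1
  · rw [ae_eq_empty, Measure.map_apply hmeas hB] at h0
    have hsub : ({1} : Set ℕ) ×ˢ (Set.univ : Set (ℕ → ℕ)) ⊆ samplePath (jumpSeq v) ⁻¹' B := by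
      rintro ⟨a, x⟩ ⟨rfl : a = 1, -⟩ j
      exact hv.monotone (le_max_right _ _)
    have := measure_mono_null hsub h0
    rw [jumpMeasure, Measure.prod_prod, measure_univ, mul_one] at this
    exact (pos 1).ne' this
  · rw [ae_eq_univ, Measure.map_apply hmeas hB.compl] at h1
    have hsub : ({0} : Set ℕ) ×ˢ ((fun x : ℕ → ℕ => x 0) ⁻¹' {0}) ⊆
        samplePath (jumpSeq v) ⁻¹' Bᶜ := by
      rintro ⟨a, x⟩ ⟨rfl : a = 0, hx : x 0 = 0⟩ hB
      have := hv.le_iff_le.1 (hB 0)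
      simp [jumpIndex, hx] at this
    have := measure_mono_null hsub h1
    rw [jumpMeasure, Measure.prod_prod, ← Measure.map_apply (measurable_pi_apply 0)
      (measurableSet_singleton 0), Measure.infinitePi_map_eval] at this
    exact mul_ne_zero (pos 0).ne' (pos 0).ne' this

/-! ### Distribution of the partial maximum -/

lemma partialMax_le_iff {Ω : Type*} (X : ℕ → Ω → ℝ) {n : ℕ} (hn : n ≠ 0) (ω : Ω) (u : ℝ) :
    partialMax X n ω ≤ u ↔ ∀ j < n, X j ω ≤ u := by
  have : Nonempty (Fin n) := ⟨⟨0, by omega⟩⟩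
  rw [partialMax, ciSup_le_iff (Set.finite_range _).bddAbove]
  exact ⟨fun h j hj => h ⟨j, hj⟩, fun h j => h j j.2⟩

lemma marginalDF_eq_maxDF_one {Ω : Type*} [MeasurableSpace Ω] (P : Measure Ω) (X : ℕ → Ω → ℝ)
    (u : ℝ) : marginalDF P X u = maxDF P X 1 u := by
  simp [marginalDF, maxDF, partialMax_le_iff]

lemma maxDF_jumpSeq_of_lt {v : ℕ → ℝ} (hv : StrictMono v) {n : ℕ} (hn : n ≠ 0) {u : ℝ}
    (hu : u < v 1) : maxDF jumpMeasure (jumpSeq v) n u = 0 := by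
  have : {ω | partialMax (jumpSeq v) n ω ≤ u} = ∅ :=
    Set.eq_empty_of_forall_notMem fun ω hω => by
      have := hv.lt_iff_lt.1
        (((partialMax_le_iff _ hn ω u).1 hω 0 (by omega)).trans_lt hu)
      omega
  rw [maxDF, this, measureReal_empty]

lemma maxDF_jumpSeq_of_forall_le {v : ℕ → ℝ} {n : ℕ} (hn : n ≠ 0) {u : ℝ}
    (hu : ∀ m, 1 ≤ m → v m ≤ u) : maxDF jumpMeasure (jumpSeq v) n u = 1 := by
  have : {ω | partialMax (jumpSeq v) n ω ≤ u} = Set.univ :=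
    Set.eq_univ_of_forall fun ω => (partialMax_le_iff _ hn ω u).2 fun j _ =>
      hu _ (le_max_of_le_left (by omega))
  rw [maxDF, this, probReal_univ]

lemma maxDF_jumpSeq_of_mem_Ico {v : ℕ → ℝ} (hv : StrictMono v) {n : ℕ} (hn : n ≠ 0) {m : ℕ}
    (hm : 1 ≤ m) {u : ℝ} (hu : u ∈ Set.Ico (v m) (v (m + 1))) :
    maxDF jumpMeasure (jumpSeq v) n u =
      (1 - 1 / ((m.sqrt : ℝ) + 1)) * (1 - 1 / (m : ℝ)) ^ n := by
  have hset : {ω | partialMax (jumpSeq v) n ω ≤ u} =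
      Set.Iio m.sqrt ×ˢ (((Finset.range n : Finset ℕ) : Set ℕ).pi fun _ => Set.Iio (m - 1)) := by
    ext ω
    have key : ∀ l, v l ≤ u ↔ l ≤ m := fun l =>
      ⟨fun h => by have := hv.lt_iff_lt.1 (h.trans_lt hu.2); omega,
        fun h => (hv.monotone h).trans hu.1⟩
    simp only [partialMax_le_iff _ hn, Set.mem_ofPred_eq, jumpSeq, key, max_le_iff, jumpIndex,
      Set.mem_prod, Set.mem_Iio, Set.mem_pi, Finset.coe_range]
    rw [← Nat.succ_le_iff, Nat.le_sqrt', Nat.succ_eq_add_one]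
    -- The constraint on `K` is read off coordinate 0, available since `n ≠ 0`.
    exact ⟨fun h => ⟨(h 0 (by omega)).2, fun j hj => by have := (h j hj).1; omega⟩,
      fun h j hj => ⟨by have := h.2 j hj; omega, h.1⟩⟩
  rw [maxDF, hset, jumpMeasure_real_prod, telescopingLaw_real_Iio, measureReal_def,
    Measure.infinitePi_pi _ fun i _ => measurableSet_Iio, ENNReal.toReal_prod]
  simp only [← measureReal_def, telescopingLaw_real_Iio, Finset.prod_const, Finset.card_range]
  rw [Nat.cast_sub hm]
  simp

/-- The last case is real: `v` may be bounded, and `u` may then lie above every atom. -/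
lemma lt_or_mem_Ico_or_forall_le (v : ℕ → ℝ) (u : ℝ) :
    u < v 1 ∨ (∃ m, 1 ≤ m ∧ u ∈ Set.Ico (v m) (v (m + 1))) ∨ ∀ m, 1 ≤ m → v m ≤ u := by
  by_contra! h
  obtain ⟨h1, h2, m, hm, hmu⟩ := h
  have : ∀ m, 1 ≤ m → v m ≤ u := fun m hm => by
    induction m, hm using Nat.le_induction with
    | base => exact h1
    | succ m hm ih => exact not_lt.1 fun hlt => h2 m hm ⟨ih, hlt⟩
  exact absurd (this m hm) (not_le.2 hmu)

/-! ### Extremal index zero -/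

/-- With `A = 1/(√m + 1)`, `B = 1/m` and marginal tail `q`, Bernoulli bounds the left side by `A + n
B`. Moreover `A ≤ q`, and `B ≤ 4 A²` because `√m + 1 ≤ 2 √m`. -/
lemma one_sub_maxDF_jumpSeq_le {v : ℕ → ℝ} (hv : StrictMono v) {n : ℕ} (hn : n ≠ 0) (u : ℝ) :
    1 - maxDF jumpMeasure (jumpSeq v) n u ≤
      4 * n * (1 - marginalDF jumpMeasure (jumpSeq v) u) ^ 2 +
        (1 - marginalDF jumpMeasure (jumpSeq v) u) := by
  rw [marginalDF_eq_maxDF_one]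
  rcases lt_or_mem_Ico_or_forall_le v u with hu | ⟨m, hm, hu⟩ | hu
  · rw [maxDF_jumpSeq_of_lt hv hn hu, maxDF_jumpSeq_of_lt hv one_ne_zero hu]
    have : (0 : ℝ) ≤ n := n.cast_nonneg
    linarith
  · rw [maxDF_jumpSeq_of_mem_Ico hv hn hm hu, maxDF_jumpSeq_of_mem_Ico hv one_ne_zero hm hu, pow_one]
    have hm' : (1 : ℝ) ≤ m := by exact_mod_cast hm
    have hs : (1 : ℝ) ≤ m.sqrt := by exact_mod_cast Nat.sqrt_pos.2 hm
    have hsm : (m.sqrt : ℝ) ^ 2 ≤ m := by exact_mod_cast Nat.sqrt_le' m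
    set s : ℝ := (m.sqrt : ℝ)
    have hA0 : 0 ≤ 1 / (s + 1) := by positivity
    have hB0 : 0 ≤ 1 / (m : ℝ) := by positivity
    have hA1 : 1 / (s + 1) ≤ 1 := by rw [div_le_one (by positivity)]; linarith
    have hB1 : 1 / (m : ℝ) ≤ 1 := by rw [div_le_one (by positivity)]; exact hm'
    have hBA : 1 / (m : ℝ) ≤ 4 * (1 / (s + 1)) ^ 2 := by
      rw [div_pow, one_pow, mul_one_div, div_le_div_iff₀ (by positivity) (by positivity)]
      nlinarith
    set A := 1 / (s + 1)
    set B := 1 / (m : ℝ)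
    have hber : 1 - n * B ≤ (1 - B) ^ n := by
      have := one_add_mul_le_pow (a := -B) (by linarith) n
      rw [← sub_eq_add_neg] at this
      linarith
    have hpow : (1 - B) ^ n ≤ 1 := pow_le_one₀ (by linarith) (by linarith)
    have hq : A ≤ 1 - (1 - A) * (1 - B) := by nlinarith
    set q := 1 - (1 - A) * (1 - B)
    have hq2 : A ^ 2 ≤ q ^ 2 := pow_le_pow_left₀ hA0 hq 2
    have hn0 : (0 : ℝ) ≤ n := n.cast_nonneg
    have h1 : n * B ≤ n * (4 * q ^ 2) := mul_le_mul_of_nonneg_left (by linarith) hn0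
    have h2 : A * (1 - B) ^ n ≤ A := mul_le_of_le_one_right hA0 hpow
    linarith
  · rw [maxDF_jumpSeq_of_forall_le hn hu, maxDF_jumpSeq_of_forall_le one_ne_zero hu]
    simp

lemma exists_tendsto_mul_one_sub_marginalDF_jumpSeq {v : ℕ → ℝ} (hv : StrictMono v) {τ : ℝ}
    (hτ : 0 < τ) : ∃ u : ℕ → ℝ,
      Tendsto (fun n : ℕ => (n : ℝ) * (1 - marginalDF jumpMeasure (jumpSeq v) (u n)))
        atTop (𝓝 τ) := by
  let s : ℕ → ℕ := fun n => ⌊τ⁻¹ * (n : ℝ)⌋₊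
  have hs : Tendsto s atTop atTop :=
    tendsto_nat_floor_atTop.comp
      (tendsto_natCast_atTop_atTop.const_mul_atTop (inv_pos.2 hτ))
  have hratio : Tendsto (fun n : ℕ => (n : ℝ) / s n) atTop (𝓝 τ) := by
    have := ((tendsto_nat_floor_mul_div_atTop (inv_pos.2 hτ).le).comp
      (tendsto_natCast_atTop_atTop (R := ℝ))).inv₀ (inv_pos.2 hτ).ne'
    simpa [s, Function.comp_def] using this
  have h1 : Tendsto (fun n => 1 / ((s n : ℝ) + 1)) atTop (𝓝 0) :=
    tendsto_one_div_add_atTop_nhds_zero_nat.comp hs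
  have h2 : Tendsto (fun n => 1 / (s n : ℝ)) atTop (𝓝 0) :=
    tendsto_one_div_atTop_nhds_zero_nat.comp hs
  have hlim := (hratio.mul h2).mul (h1.const_sub 1) |>.add (hratio.mul (h1.const_sub 1))
  simp only [mul_zero, sub_zero, mul_one, zero_add] at hlim
  -- At level `v (s²)` the marginal tail is exactly `1/s`, so `s ≈ n/τ` is the right choice.
  refine ⟨fun n => v (s n ^ 2), hlim.congr' ?_⟩
  filter_upwards [hs.eventually_ge_atTop 1] with n hn
  have hm : 1 ≤ s n ^ 2 := Nat.one_le_pow _ _ hn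
  have hn' : (s n : ℝ) ≠ 0 := by exact_mod_cast (Nat.one_le_iff_ne_zero.1 hn)
  rw [marginalDF_eq_maxDF_one,
    maxDF_jumpSeq_of_mem_Ico hv one_ne_zero hm ⟨le_rfl, hv (Nat.lt_succ_self _)⟩, Nat.sqrt_eq',
    pow_one]
  push_cast
  field_simp
  ring

lemma jumpSeq_hasExtremalIndexZero {v : ℕ → ℝ} (hv : StrictMono v) :
    HasExtremalIndexZero jumpMeasure (jumpSeq v) := by
  refine fun τ hτ => ⟨exists_tendsto_mul_one_sub_marginalDF_jumpSeq hv hτ, fun u hu => ?_⟩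
  have hq : Tendsto (fun n => 1 - marginalDF jumpMeasure (jumpSeq v) (u n)) atTop (𝓝 0) := by
    have := hu.mul (tendsto_one_div_atTop_nhds_zero_nat (𝕜 := ℝ))
    rw [mul_zero] at this
    refine this.congr' ?_
    filter_upwards [eventually_ne_atTop 0] with n hn
    field_simp
  -- The bound `4 n q² + q` is `4 (n q) q + q`, with `n q → τ` and `q → 0`.
  have hbound := ((hu.mul hq).const_mul 4).add hq
  simp only [mul_zero, add_zero] at hbound
  have hlow := hbound.const_sub 1
  rw [sub_zero] at hlow
  refine tendsto_of_tendsto_of_tendsto_of_le_of_le' hlow tendsto_const_nhds ?_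
    (Eventually.of_forall fun n => measureReal_le_one)
  filter_upwards [eventually_ne_atTop 0] with n hn
  have := one_sub_maxDF_jumpSeq_le hv hn (u n)
  linarith

/-! ### The continuous interpolated distribution function -/

/-- A continuous distribution function through the points `(v m, 1 - 1 / m)`, `m ≥ 1`, obtained
by linear interpolation. -/
def interpDF (v : ℕ → ℝ) (u : ℝ) : ℝ :=
  ∑' i, telescopingWeight i * max 0 (min 1 ((u - v (i + 1)) / (v (i + 2) - v (i + 1))))

lemma interpDF_term_nonneg (v : ℕ → ℝ) (u : ℝ) (i : ℕ) :
    0 ≤ telescopingWeight i * max 0 (min 1 ((u - v (i + 1)) / (v (i + 2) - v (i + 1)))) :=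
  mul_nonneg (telescopingWeight_pos i).le (le_max_left _ _)

lemma interpDF_term_le (v : ℕ → ℝ) (u : ℝ) (i : ℕ) :
    telescopingWeight i * max 0 (min 1 ((u - v (i + 1)) / (v (i + 2) - v (i + 1)))) ≤
      telescopingWeight i :=
  mul_le_of_le_one_right (telescopingWeight_pos i).le (max_le zero_le_one (min_le_left _ _))

lemma summable_interpDF_term (v : ℕ → ℝ) (u : ℝ) :
    Summable fun i =>
      telescopingWeight i * max 0 (min 1 ((u - v (i + 1)) / (v (i + 2) - v (i + 1)))) :=
  hasSum_telescopingWeight.summable.of_nonneg_of_le (interpDF_term_nonneg v u)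
    (interpDF_term_le v u)

lemma interpDF_nonneg (v : ℕ → ℝ) (u : ℝ) : 0 ≤ interpDF v u :=
  tsum_nonneg (interpDF_term_nonneg v u)

lemma interpDF_le_one (v : ℕ → ℝ) (u : ℝ) : interpDF v u ≤ 1 :=
  hasSum_telescopingWeight.tsum_eq ▸ (summable_interpDF_term v u).tsum_le_tsum
    (interpDF_term_le v u) hasSum_telescopingWeight.summable

lemma continuous_interpDF (v : ℕ → ℝ) : Continuous (interpDF v) :=
  continuous_tsum (fun i => by fun_prop) hasSum_telescopingWeight.summable fun i u => by
    rw [Real.norm_of_nonneg (interpDF_term_nonneg v u i)]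
    exact interpDF_term_le v u i

lemma monotone_interpDF {v : ℕ → ℝ} (hv : StrictMono v) : Monotone (interpDF v) := fun a b hab =>
  (summable_interpDF_term v a).tsum_le_tsum (fun i => by
    have : 0 ≤ v (i + 2) - v (i + 1) := sub_nonneg.2 (hv.monotone (by omega))
    have := (telescopingWeight_pos i).le
    gcongr) (summable_interpDF_term v b)

/-- Ramp `i` rises over `[v (i+1), v (i+2)]`: beyond `v (m+1)` the ramps `i < m` are saturated.
Dually, up to `v (m+1)` the ramps `i ≥ m` vanish, which gives `interpDF_le`. -/
lemma le_interpDF {v : ℕ → ℝ} (hv : StrictMono v) {m : ℕ} {u : ℝ} (hu : v (m + 1) ≤ u) :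
    1 - 1 / ((m : ℝ) + 1) ≤ interpDF v u := by
  rw [← sum_range_telescopingWeight]
  refine le_trans (Finset.sum_le_sum fun i hi => ?_)
    ((summable_interpDF_term v u).sum_le_tsum (Finset.range m) fun i _ => interpDF_term_nonneg v u i)
  have hi : v (i + 2) ≤ u :=
    (hv.monotone (by have := Finset.mem_range.1 hi; omega)).trans hu
  have h1 : 1 ≤ (u - v (i + 1)) / (v (i + 2) - v (i + 1)) := by
    rw [one_le_div (sub_pos.2 (hv (by omega)))]
    linarith
  rw [min_eq_left h1, max_eq_right zero_le_one, mul_one]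

lemma interpDF_le {v : ℕ → ℝ} (hv : StrictMono v) {m : ℕ} {u : ℝ} (hu : u ≤ v (m + 1)) :
    interpDF v u ≤ 1 - 1 / ((m : ℝ) + 1) := by
  rw [← sum_range_telescopingWeight, interpDF, tsum_eq_sum (s := Finset.range m)]
  · exact Finset.sum_le_sum fun i _ => interpDF_term_le v u i
  · intro i hi
    have hi : u ≤ v (i + 1) :=
      hu.trans (hv.monotone (by have := Finset.mem_range.not.1 hi; omega))
    have h0 : (u - v (i + 1)) / (v (i + 2) - v (i + 1)) ≤ 0 :=
      div_nonpos_of_nonpos_of_nonneg (sub_nonpos.2 hi) (sub_nonneg.2 (hv.monotone (by omega)))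
    rw [max_eq_left ((min_le_right _ _).trans h0), mul_zero]

lemma interpDF_eq_one {v : ℕ → ℝ} (hv : StrictMono v) {u : ℝ} (hu : ∀ m, 1 ≤ m → v m ≤ u) :
    interpDF v u = 1 := by
  have h : Tendsto (fun m : ℕ => 1 - 1 / ((m : ℝ) + 1)) atTop (𝓝 1) := by
    simpa using tendsto_one_div_add_atTop_nhds_zero_nat (𝕜 := ℝ) |>.const_sub 1
  exact le_antisymm (interpDF_le_one v u)
    (le_of_tendsto' h fun m => le_interpDF hv (hu (m + 1) (by omega)))

lemma isDistributionFunction_interpDF {v : ℕ → ℝ} (hv : StrictMono v) :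
    IsDistributionFunction (interpDF v) where
  mono := monotone_interpDF hv
  right_cont x := (continuous_interpDF v).continuousWithinAt
  lim_bot := by
    refine tendsto_const_nhds.congr' ?_
    filter_upwards [eventually_le_atBot (v 1)] with u hu
    have := interpDF_le hv (m := 0) hu
    exact le_antisymm (interpDF_nonneg v u) (by simpa using this)
  lim_top := by
    refine tendsto_order.2 ⟨fun a ha => ?_, fun a ha =>
      Eventually.of_forall fun u => (interpDF_le_one v u).trans_lt ha⟩
    obtain ⟨m, hm⟩ := exists_nat_one_div_lt (sub_pos.2 ha)
    filter_upwards [eventually_ge_atTop (v (m + 1))] with u hu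
    have := le_interpDF hv hu
    linarith

/-! ### Uniform comparison with the phantom -/

/-- Factor `1 - 1/m = (1 - 1/(m+1)) (1 - 1/m²)`. Bernoulli makes the difference at most `(1 +
1/m)^(-n) · n/m²`, and Bernoulli again, `(1 + 1/m)^n ≥ n/m`, absorbs `n`, so the bound is uniform in
`n`. -/
lemma pow_one_sub_inv_succ_sub_pow_le {m : ℝ} (hm : 1 ≤ m) (n : ℕ) :
    (1 - 1 / (m + 1)) ^ n - (1 - 1 / m) ^ n ≤ 1 / m := by
  have hm0 : 0 < m := by linarith
  have hfac : 1 - 1 / m = (1 - 1 / (m + 1)) * (1 - 1 / m ^ 2) := by field_simp; ring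
  have hinv : 1 - 1 / (m + 1) = (1 + 1 / m)⁻¹ := by field_simp; ring
  have h1 : 1 - n * (1 / m ^ 2) ≤ (1 - 1 / m ^ 2) ^ n := by
    have : 1 / m ^ 2 ≤ 1 := by
      rw [div_le_one (by positivity)]
      exact one_le_pow₀ hm
    have := one_add_mul_le_pow (a := -(1 / m ^ 2)) (by linarith) n
    rw [← sub_eq_add_neg] at this
    linarith
  have h2 : 1 + n * (1 / m) ≤ (1 + 1 / m) ^ n :=
    one_add_mul_le_pow (by have : 0 < 1 / m := by positivity
                           linarith) n
  have hn : (0 : ℝ) ≤ n := n.cast_nonneg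
  rw [hfac, mul_pow, hinv, inv_pow]
  set y := (1 + 1 / m) ^ n
  have hy : 0 < y := by positivity
  have h3 : n / m ^ 2 ≤ y * (1 / m) := by
    calc (n : ℝ) / m ^ 2 = n * (1 / m) * (1 / m) := by field_simp
      _ ≤ y * (1 / m) := by gcongr; linarith
  calc y⁻¹ - y⁻¹ * (1 - 1 / m ^ 2) ^ n = y⁻¹ * (1 - (1 - 1 / m ^ 2) ^ n) := by ring
    _ ≤ y⁻¹ * (n / m ^ 2) := by gcongr; rw [← mul_one_div (n : ℝ)]; linarith
    _ ≤ y⁻¹ * (y * (1 / m)) := by gcongr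
    _ = 1 / m := by field_simp

/-- Split at `m = S²`. Below, both quantities are at most the geometric term. Above, the factor due
to `K` costs at most `1/(√m + 1) ≤ 1/S` and the interpolation at most `1/m ≤ 1/S`. The bound is free
of `u`, so letting `n → ∞` and then `S → ∞` handles every sequence of levels. -/
lemma abs_maxDF_jumpSeq_sub_interpDF_pow_le {v : ℕ → ℝ} (hv : StrictMono v) {n : ℕ} (hn : n ≠ 0)
    {S : ℕ} (hS : 1 ≤ S) (u : ℝ) :
    |maxDF jumpMeasure (jumpSeq v) n u - interpDF v u ^ n| ≤
      (1 - 1 / ((S : ℝ) ^ 2 + 1)) ^ n + 2 / S := by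
  have hS' : (1 : ℝ) ≤ S := by exact_mod_cast hS
  have hbase : 0 ≤ 1 - 1 / ((S : ℝ) ^ 2 + 1) := by
    rw [sub_nonneg, div_le_one (by positivity)]
    nlinarith
  have hrhs : 0 ≤ (1 - 1 / ((S : ℝ) ^ 2 + 1)) ^ n + 2 / S := by positivity
  rcases lt_or_mem_Ico_or_forall_le v u with hu | ⟨m, hm, hu⟩ | hu
  · have := interpDF_le hv (m := 0) hu.le
    have : interpDF v u = 0 := le_antisymm (by simpa using this) (interpDF_nonneg v u)
    rw [maxDF_jumpSeq_of_lt hv hn hu, this, zero_pow hn]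
    simpa using hrhs
  · rw [maxDF_jumpSeq_of_mem_Ico hv hn hm hu]
    have hm' : (1 : ℝ) ≤ m := by exact_mod_cast hm
    have hlow : 1 - 1 / (m : ℝ) ≤ interpDF v u := by
      obtain ⟨l, rfl⟩ : ∃ l, m = l + 1 := ⟨m - 1, by omega⟩
      have := le_interpDF hv hu.1
      push_cast
      exact this
    have hupp : interpDF v u ≤ 1 - 1 / ((m : ℝ) + 1) := interpDF_le hv hu.2.le
    have ha0 : 0 ≤ 1 - 1 / (m : ℝ) := by
      rw [sub_nonneg, div_le_one (by positivity)]; exact hm'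
    have hG0 : (1 - 1 / (m : ℝ)) ^ n ≤ interpDF v u ^ n := pow_le_pow_left₀ ha0 hlow n
    have hG1 : interpDF v u ^ n ≤ (1 - 1 / ((m : ℝ) + 1)) ^ n :=
      pow_le_pow_left₀ (interpDF_nonneg v u) hupp n
    have hdiff := pow_one_sub_inv_succ_sub_pow_le hm' n
    have hp0 : 0 ≤ (1 - 1 / (m : ℝ)) ^ n := pow_nonneg ha0 n
    have hp1 : (1 - 1 / (m : ℝ)) ^ n ≤ 1 :=
      pow_le_one₀ ha0 (by have : 0 ≤ 1 / (m : ℝ) := by positivity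
                          linarith)
    have hA0 : 0 ≤ 1 / ((m.sqrt : ℝ) + 1) := by positivity
    have hA1 : 1 / ((m.sqrt : ℝ) + 1) ≤ 1 := by
      rw [div_le_one (by positivity)]; linarith [(m.sqrt).cast_nonneg (α := ℝ)]
    have hAp : 1 / ((m.sqrt : ℝ) + 1) * (1 - 1 / (m : ℝ)) ^ n ≤ 1 / ((m.sqrt : ℝ) + 1) :=
      mul_le_of_le_one_right hA0 hp1
    have hAp0 : 0 ≤ 1 / ((m.sqrt : ℝ) + 1) * (1 - 1 / (m : ℝ)) ^ n := mul_nonneg hA0 hp0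
    have hH0 : 0 ≤ (1 - 1 / ((m.sqrt : ℝ) + 1)) * (1 - 1 / (m : ℝ)) ^ n :=
      mul_nonneg (sub_nonneg.2 hA1) hp0
    rw [abs_sub_comm, abs_of_nonneg (by linarith)]
    rcases le_total m (S ^ 2) with hmS | hmS
    · have hmS' : (m : ℝ) ≤ (S : ℝ) ^ 2 := by exact_mod_cast hmS
      have : (1 - 1 / ((m : ℝ) + 1)) ^ n ≤ (1 - 1 / ((S : ℝ) ^ 2 + 1)) ^ n := by
        refine pow_le_pow_left₀ ((interpDF_nonneg v u).trans hupp) ?_ n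
        gcongr
      have : (0 : ℝ) ≤ 2 / S := by positivity
      linarith
    · have hs : (S : ℝ) ≤ m.sqrt := by exact_mod_cast Nat.le_sqrt'.2 hmS
      have hmS' : (S : ℝ) ≤ m := hs.trans (by exact_mod_cast m.sqrt_le_self)
      have h1 : 1 / ((m.sqrt : ℝ) + 1) ≤ 1 / S :=
        one_div_le_one_div_of_le (by positivity) (by linarith)
      have h2 : 1 / (m : ℝ) ≤ 1 / S := one_div_le_one_div_of_le (by positivity) hmS'
      have h3 : (2 : ℝ) / S = 1 / S + 1 / S := by ring
      have := pow_nonneg hbase n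
      linarith
  · rw [maxDF_jumpSeq_of_forall_le hn hu, interpDF_eq_one hv hu]
    simpa using hrhs

lemma interpDF_isPhantomDF {v : ℕ → ℝ} (hv : StrictMono v) :
    IsPhantomDF jumpMeasure (jumpSeq v) (interpDF v) := by
  refine ⟨isDistributionFunction_interpDF hv, fun u => Metric.tendsto_nhds.2 fun ε hε => ?_⟩
  obtain ⟨S, hS, hS1⟩ : ∃ S : ℕ, (2 : ℝ) / S < ε / 2 ∧ 1 ≤ S :=
    (((tendsto_const_div_atTop_nhds_zero_nat (2 : ℝ)).eventually_lt_const
      (half_pos hε)).and (eventually_ge_atTop 1)).exists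
  have hS' : (1 : ℝ) ≤ S := by exact_mod_cast hS1
  have hpow : Tendsto (fun n => (1 - 1 / ((S : ℝ) ^ 2 + 1)) ^ n) atTop (𝓝 0) := by
    refine tendsto_pow_atTop_nhds_zero_of_lt_one ?_ ?_
    · rw [sub_nonneg, div_le_one (by positivity)]
      nlinarith
    · have : 0 < 1 / ((S : ℝ) ^ 2 + 1) := by positivity
      linarith
  filter_upwards [hpow.eventually_lt_const (half_pos hε), eventually_ne_atTop 0] with n h1 hn
  rw [Real.dist_eq, sub_zero]
  have := abs_maxDF_jumpSeq_sub_interpDF_pow_le hv hn hS1 (u n)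
  linarith

end

theorem mainTheorem6 (v : ℕ → ℝ) (hv : StrictMono v) :
    ∃ (Ω : Type) (_ : MeasurableSpace Ω) (P : Measure Ω) (K : Ω → ℕ) (X : ℕ → Ω → ℝ),
      IsProbabilityMeasure P ∧
      IsJumpMixture P v K X ∧
      IsStationarySeq P X ∧
      IsExchangeableSeq P X ∧
      (∃ G : ℝ → ℝ, Continuous G ∧ IsPhantomDF P X G) ∧
      HasExtremalIndexZero P X ∧
      ¬ IsErgodicSeq P X :=
  ⟨ℕ × (ℕ → ℕ), inferInstance, jumpMeasure, jumpIndex, jumpSeq v, inferInstance,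
    jumpMeasure_isJumpMixture hv, jumpSeq_isStationarySeq v, jumpSeq_isExchangeableSeq v,
    ⟨interpDF v, continuous_interpDF v, interpDF_isPhantomDF hv⟩,
    jumpSeq_hasExtremalIndexZero hv, jumpSeq_not_isErgodicSeq hv⟩
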